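/- Let $G$ be an infinite countable discrete amenable group acting continuously on a compact metrizable space $X$. For a compact metrizable space $Z$ with a compatible metric $\rho$ and $\epsilon>0$, let $\mathrm{Widim}_\epsilon(Z,\rho)$ be the least Lebesgue covering dimension of a compact metrizable space $P$ admitting a continuous map $f:Z\to P$ such that $f(z)=f(z')$ implies $\rho(z,z')<\epsilon$ (the empty space has dimension $-\infty$). If $G$ acts continuously on $Z$ and $F\subset G$ is finite and nonempty, put $\rho_F(z,z')=\max_{g\in F}\rho(gz,gz')$. The mean dimension is $$\mathrm{mdim}(Z,G)=\lim_{\epsilon\to0}\lim_{k\to\infty}\frac{\mathrm{Widim}_\epsilon(Z,\rho_{F_k})}{|F_k|},$$ where $(F_k)$ is a F\o{}lner sequence of $G$, i.e. the $F_k$ are nonempty finite subsets of $G$ with $|F_k\triangle gF_k|/|F_k|\to0$ for every $g\in G$. For $1\le n\le\infty$ let $G$ act diagonally on $X^n$ ($X^\infty$ being the product of countably infinitely many copies of $X$), and let $X^0$ be the one-point space. Then, for $Z=X$ and for $Z=X^n$ with $n\in\{0,1,2,\dots\}\cup\{\infty\}$, these limits exist and do not depend on the choice of the compatible metric $\rho$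 and of the F\o{}lner sequence, and $$\mathrm{mdim}(X^n,G)=n\cdot\mathrm{mdim}(X,G)\qquad\text{for all }n\in\{0,1,2,\dots\}\cup\{\infty\},$$ with the conventions $0\cdot(\pm\infty)=\infty\cdot0=0$. -/

import Mathlib

open Filter Topology
open scoped Pointwise symmDiff

universe u v

/-- The (Lebesgue) covering dimension of `P` is at most `n`: every finite open cover of `P` has a
finite open refinement, covering `P`, such that every point lies in at most `n + 1` of its
members. -/
def CoveringDimLE (P : Type u) [TopologicalSpace P] (n : ℕ) : Prop :=
  ∀ 𝒰 : Set (Set P), 𝒰.Finite → (∀ U ∈ 𝒰, IsOpen U) → ⋃₀ 𝒰 = Set.univ →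
    ∃ 𝒱 : Set (Set P), 𝒱.Finite ∧ (∀ V ∈ 𝒱, IsOpen V) ∧ ⋃₀ 𝒱 = Set.univ ∧
      (∀ V ∈ 𝒱, ∃ U ∈ 𝒰, V ⊆ U) ∧ ∀ x : P, {V ∈ 𝒱 | x ∈ V}.ncard ≤ n + 1

open Classical in
/-- The (Lebesgue) covering dimension, with value `-∞` for the empty space and `+∞` for an
infinite dimensional space. -/
noncomputable def coveringDim (P : Type u) [TopologicalSpace P] : EReal :=
  if IsEmpty P then ⊥ else ⨅ (n : ℕ) (_ : CoveringDimLE P n), (n : EReal)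

/-- `ρ` is a metric on `X` which induces the given topology of `X`. -/
def IsCompatibleMetric {X : Type u} [t : TopologicalSpace X] (ρ : X → X → ℝ) : Prop :=
  ∃ m : MetricSpace X, m.toUniformSpace.toTopologicalSpace = t ∧ ∀ x y, ρ x y = m.dist x y

/-- `f` is an `ε`-embedding with respect to `ρ`. -/
def IsEpsEmbedding {X P : Type u} [TopologicalSpace X] [TopologicalSpace P]
    (ρ : X → X → ℝ) (ε : ℝ) (f : X → P) : Prop :=
  Continuous f ∧ ∀ x x' : X, f x = f x' → ρ x x' < ε

/-- `Widim_ε(X, ρ)`: the least covering dimension of a compact metrizable space which admits an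
`ε`-embedding of `X`. -/
noncomputable def widim {X : Type u} [TopologicalSpace X] (ε : ℝ) (ρ : X → X → ℝ) : EReal :=
  sInf {d : EReal | ∃ (P : Type u) (_ : TopologicalSpace P) (_ : CompactSpace P)
    (_ : TopologicalSpace.MetrizableSpace P) (f : X → P),
      IsEpsEmbedding ρ ε f ∧ d = coveringDim P}

/-- The metric `ρ_F(x, x') = max_{g ∈ F} ρ(g x, g x')`, for a nonempty finite set `F`. -/
noncomputable def dynMetric {G : Type v} {X : Type u} [SMul G X]
    (ρ : X → X → ℝ) (F : Finset G) (x x' : X) : ℝ :=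
  ⨆ g : F, ρ ((g : G) • x) ((g : G) • x')

/-- Følner sequences: nonempty finite sets `F k` with `|F k ∆ g (F k)| / |F k| → 0` for all
`g`. -/
def IsFolnerSeq {G : Type v} [Group G] (F : ℕ → Finset G) : Prop :=
  (∀ k, (F k).Nonempty) ∧
    ∀ g : G, Tendsto
      (fun k => (((F k : Set G) ∆ (g • (F k : Set G))).ncard : ℝ) / ((F k).card : ℝ))
      atTop (𝓝 0)

/-- A (countable discrete) group is amenable if it has a Følner sequence. -/
def IsAmenable (G : Type v) [Group G] : Prop :=
  ∃ F : ℕ → Finset G, IsFolnerSeq F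

/-- `m` is the mean dimension of the action of `G` on `X`: for every compatible metric `ρ` on `X`
and every Følner sequence `F`, the limit `w ε = lim_k Widim_ε(X, ρ_{F k}) / |F k|` exists for all
`ε > 0`, and `m = lim_{ε → 0} w ε`. -/
def IsMeanDim (G : Type v) (X : Type u) [Group G] [TopologicalSpace X] [MulAction G X]
    (m : EReal) : Prop :=
  ∀ ρ : X → X → ℝ, IsCompatibleMetric ρ → ∀ F : ℕ → Finset G, IsFolnerSeq F →
    ∃ w : ℝ → EReal,
      (∀ ε : ℝ, 0 < ε →
        Tendsto (fun k => widim ε (dynMetric ρ (F k)) / ((F k).card : EReal)) atTop (𝓝 (w ε))) ∧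
      Tendsto w (𝓝[>] 0) (𝓝 m)

/-- The mean dimension `mdim(X, G)`. For an amenable `G` and a metrizable `X` at most one value
satisfies `IsMeanDim G X`; that it exists has to be stated separately wherever `mdim` is used. -/
noncomputable def mdim (G : Type v) (X : Type u) [Group G] [TopologicalSpace X] [MulAction G X] :
    EReal :=
  Classical.epsilon (IsMeanDim G X)

/-! Covering dimension is only subadditive under products, and `dim (X × X) < 2 dim X` does occur;
averaging over an infinite group removes this defect. Upper bound: products of `ε`-embeddings give
`Widim_ε(X^n, ρ_F) ≤ n Widim_ε(X, ρ_F)`, which rests on `dim (P × Q) ≤ dim P + dim Q`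
(`CoveringDimLE.prod`). Lower bound: as `G` is infinite, each Følner set `A k` has `n` pairwise
disjoint right translates `A k * {c}`, `c ∈ C k`. The map `x ↦ (c • x)_c` pulls the `A k`-metric of
`X^n` back to the `A k * C k`-metric of `X`, so `Widim_ε(X, ρ_{A k * C k}) ≤ Widim_ε(X^n, ρ_{A k})`.
The sets `A k * C k` again form a Følner sequence, of cardinality `n |A k|`, so division by `|A k|`
yields the factor `n`. This needs the limit to be the same for all Følner sequences, which is the
Ornstein–Weiss lemma (`IsSubadditiveInvariant.exists_tendsto`), proved by greedy quasitiling. For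
`X^∞`: it contains every `X^n`, `n ≥ 1`, as periodic sequences, and at scale `ε` only finitely many
coordinates matter. -/

/-! ### Covering dimension of products -/

/-- If `dim P ≤ n`, then every finite open cover has, for every `k`, open refinements consisting of
`k` families of pairwise disjoint sets such that every point is missed by at most `n` of them. -/
theorem CoveringDimLE.exists_disjoint_families {P : Type u} [TopologicalSpace P] [CompactSpace P]
    [T2Space P] {n : ℕ} (h : CoveringDimLE P n) {𝒰 : Set (Set P)} (hfin : 𝒰.Finite)
    (hopen : ∀ U ∈ 𝒰, IsOpen U) (hcov : ⋃₀ 𝒰 = Set.univ) (k : ℕ) :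
    ∃ (ι : Type u) (_ : Finite ι) (W : Fin k → ι → Set P), (∀ j i, IsOpen (W j i)) ∧
      (∀ j i, (W j i).Nonempty → ∃ U ∈ 𝒰, W j i ⊆ U) ∧
      (∀ j i i' x, x ∈ W j i → x ∈ W j i' → i = i') ∧
      ∀ x, ∃ s : Finset (Fin k), s.card ≤ n ∧ ∀ j ∉ s, ∃ i, x ∈ W j i := by
  classical
  obtain ⟨𝒱, hVfin, hVopen, hVcov, hVref, hVord⟩ := h 𝒰 hfin hopen hcov
  have : Finite 𝒱 := hVfin
  obtain ⟨f, hf⟩ := BumpCovering.exists_isSubordinate (X := P) isClosed_univ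
    (fun v : 𝒱 => (v : Set P)) (fun v => hVopen v v.2)
    (by rw [← Set.sUnion_eq_iUnion, hVcov])
  have hone : ∀ x, ∃ v, f v x = 1 := fun x => by
    obtain ⟨v, hv⟩ := f.eventuallyEq_one' x (Set.mem_univ x)
    exact ⟨v, hv.eq_of_nhds⟩
  have hmem : ∀ v x, 0 < f v x → x ∈ (v : Set P) := fun v x hx =>
    hf v (subset_tsupport _ (Function.mem_support.2 hx.ne'))
  -- The `k` levels are distinct and lie strictly between 0 and 1: positive, so that exceeding one
  -- forces membership in `v`; below 1, so that at every point some `f v` exceeds all of them.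
  let t : Fin k → ℝ := fun j => ((j : ℕ) + 1) / (k + 1)
  have ht0 : ∀ j, 0 < t j := fun j => by positivity
  have ht1 : ∀ j, t j < 1 := fun j => by
    rw [div_lt_one (by positivity)]
    have : ((j : ℕ) : ℝ) < k := by exact_mod_cast j.2
    linarith
  have htinj : Function.Injective t := fun i j hij => by
    have hk : (k + 1 : ℝ) ≠ 0 := by positivity
    have := (div_left_inj' hk).1 hij
    exact Fin.ext (by exact_mod_cast add_right_cancel this)
  -- The family at level `j` sorts points by the set `S` of those `v` with `f v x > t j`, and drops
  -- points where some `f v` equals `t j`.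
  refine ⟨Set 𝒱, inferInstance,
    fun j S => {x | ∀ v, (v ∈ S → t j < f v x) ∧ (v ∉ S → f v x < t j)}, ?_, ?_, ?_, ?_⟩
  · intro j S
    simp only [Set.ofPred_forall]
    refine isOpen_iInter_of_finite fun v => ?_
    by_cases hv : v ∈ S
    · simpa [hv] using isOpen_lt continuous_const (f v).continuous
    · simpa [hv] using isOpen_lt (f v).continuous continuous_const
  · rintro j S ⟨x, hx⟩
    obtain ⟨v, hv⟩ := hone x
    have hvS : v ∈ S := by
      by_contra hvS
      have := (hx v).2 hvS
      linarith [ht1 j]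
    obtain ⟨U, hU, hVU⟩ := hVref v v.2
    exact ⟨U, hU, fun y hy => hVU (hmem v y ((ht0 j).trans ((hy v).1 hvS)))⟩
  · intro j S S' x hx hx'
    ext v
    constructor
    · intro hv
      by_contra hv'
      exact lt_asymm ((hx v).1 hv) ((hx' v).2 hv')
    · intro hv
      by_contra hv'
      exact lt_asymm ((hx' v).1 hv) ((hx v).2 hv')
  · intro x
    -- Distinct missed levels are attained by distinct members of the cover containing `x`, none of
    -- them `v₀`, where the value is 1. That leaves at most `(n + 1) - 1` levels.
    refine ⟨Finset.univ.filter fun j => ∃ v, f v x = t j, ?_, ?_⟩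
    · obtain ⟨v₀, hv₀⟩ := hone x
      set A : Set (Set P) := {V ∈ 𝒱 | x ∈ V} with hA
      have hAfin : A.Finite := hVfin.subset fun V hV => hV.1
      have hv₀A : (v₀ : Set P) ∈ A := ⟨v₀.2, hmem v₀ x (by rw [hv₀]; exact one_pos)⟩
      let c : Fin k → Set P := fun j => if hj : ∃ v, f v x = t j then (hj.choose : Set P) else ∅
      have hc : ∀ j, (∃ v, f v x = t j) → ∃ v : 𝒱, c j = v ∧ f v x = t j := fun j hj =>
        ⟨hj.choose, by simp only [c, dif_pos hj], hj.choose_spec⟩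
      have hle : (Finset.univ.filter fun j => ∃ v, f v x = t j).card ≤ (A \ {(v₀ : Set P)}).ncard := by
        rw [← Set.ncard_coe_finset]
        refine Set.ncard_le_ncard_of_injOn c ?_ ?_ (hAfin.subset Set.sdiff_subset)
        · intro j hj
          obtain ⟨v, hcv, hv⟩ := hc j (by simpa using hj)
          rw [hcv]
          refine ⟨⟨v.2, hmem v x (hv ▸ ht0 j)⟩, fun hvv => ?_⟩
          have : v = v₀ := Subtype.ext hvv
          rw [this, hv₀] at hv
          linarith [ht1 j]
        · intro i hi j hj hij
          obtain ⟨v, hcv, hv⟩ := hc i (by simpa using hi)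
          obtain ⟨w, hcw, hw⟩ := hc j (by simpa using hj)
          have : v = w := Subtype.ext (by rw [← hcv, ← hcw, hij])
          exact htinj (by rw [← hv, ← hw, this])
      rw [Set.ncard_sdiff_singleton_of_mem hv₀A] at hle
      have : A.ncard ≤ n + 1 := hVord x
      omega
    · intro j hj
      refine ⟨{v | t j < f v x}, fun v => ⟨fun hv => hv, fun hv => ?_⟩⟩
      refine lt_of_le_of_ne (not_lt.1 hv) fun heq => hj ?_
      simpa using ⟨v.1, v.2, heq⟩

/-- The product theorem of dimension theory, for compact metrizable spaces. -/
theorem CoveringDimLE.prod {P Q : Type u} [TopologicalSpace P] [CompactSpace P]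
    [TopologicalSpace.MetrizableSpace P] [TopologicalSpace Q] [CompactSpace Q]
    [TopologicalSpace.MetrizableSpace Q] {n m : ℕ} (hP : CoveringDimLE P n)
    (hQ : CoveringDimLE Q m) : CoveringDimLE (P × Q) (n + m) := by
  classical
  intro 𝒰 _ hopen hcov
  let _ := TopologicalSpace.metrizableSpaceMetric P
  let _ := TopologicalSpace.metrizableSpaceMetric Q
  obtain ⟨δ, hδ, hball⟩ := lebesgue_number_lemma_of_metric_sUnion (α := P × Q) isCompact_univ hopen
    hcov.ge
  have hnet : ∀ (R : Type u) [PseudoMetricSpace R] [CompactSpace R], ∃ 𝒜 : Set (Set R),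
      𝒜.Finite ∧ (∀ A ∈ 𝒜, IsOpen A) ∧ ⋃₀ 𝒜 = Set.univ ∧
        ∀ A ∈ 𝒜, ∃ x, A = Metric.ball x δ := by
    intro R _ _
    obtain ⟨s, hs, hsc⟩ := (Metric.totallyBounded_iff.1 (isCompact_univ (X := R)).totallyBounded δ hδ)
    refine ⟨(fun x => Metric.ball x δ) '' s, hs.image _, ?_, ?_, ?_⟩
    · rintro _ ⟨x, -, rfl⟩
      exact Metric.isOpen_ball
    · rw [Set.sUnion_image]
      exact Set.univ_subset_iff.1 hsc
    · rintro _ ⟨x, -, rfl⟩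
      exact ⟨x, rfl⟩
  obtain ⟨𝒜, hAf, hAo, hAc, hAb⟩ := hnet P
  obtain ⟨ℬ, hBf, hBo, hBc, hBb⟩ := hnet Q
  -- With `n + m + 1` levels, of which a point misses at most `n` in `P` and `m` in `Q`, one level
  -- serves both coordinates; disjointness leaves at most one box per level at each point.
  obtain ⟨ι, _, V, hVo, hVr, hVd, hVc⟩ := hP.exists_disjoint_families hAf hAo hAc (n + m + 1)
  obtain ⟨κ, _, W, hWo, hWr, hWd, hWc⟩ := hQ.exists_disjoint_families hBf hBo hBc (n + m + 1)
  let T : Fin (n + m + 1) × ι × κ → Set (P × Q) := fun a => V a.1 a.2.1 ×ˢ W a.1 a.2.2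
  refine ⟨{S ∈ Set.range T | S.Nonempty}, (Set.finite_range T).subset fun S hS => hS.1, ?_, ?_, ?_,
    ?_⟩
  · rintro _ ⟨⟨a, rfl⟩, -⟩
    exact (hVo _ _).prod (hWo _ _)
  · refine Set.eq_univ_of_forall fun x => ?_
    obtain ⟨s, hs, hsj⟩ := hVc x.1
    obtain ⟨s', hs', hsj'⟩ := hWc x.2
    obtain ⟨j, hj⟩ : ∃ j, j ∉ s ∪ s' := by
      by_contra! hall
      have h1 : (Finset.univ : Finset (Fin (n + m + 1))) ⊆ s ∪ s' := fun j _ => hall j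
      have h2 := (Finset.card_le_card h1).trans (Finset.card_union_le s s')
      rw [Finset.card_univ, Fintype.card_fin] at h2
      omega
    rw [Finset.mem_union, not_or] at hj
    obtain ⟨i, hi⟩ := hsj j hj.1
    obtain ⟨i', hi'⟩ := hsj' j hj.2
    exact ⟨T (j, i, i'), ⟨⟨_, rfl⟩, x, hi, hi'⟩, hi, hi'⟩
  · rintro _ ⟨⟨⟨j, i, i'⟩, rfl⟩, y, hy, hy'⟩
    obtain ⟨A, hA, hVA⟩ := hVr j i ⟨_, hy⟩
    obtain ⟨B, hB, hWB⟩ := hWr j i' ⟨_, hy'⟩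
    obtain ⟨p, rfl⟩ := hAb A hA
    obtain ⟨q, rfl⟩ := hBb B hB
    obtain ⟨U, hU, hUb⟩ := hball (p, q) (Set.mem_univ _)
    refine ⟨U, hU, fun z hz => hUb ?_⟩
    rw [← ball_prod_same]
    exact ⟨hVA hz.1, hWB hz.2⟩
  · intro x
    -- By disjointness, `c j` is the only level-`j` box containing `x`, or empty if there is none.
    let c : Fin (n + m + 1) → Set (P × Q) := fun j => {y | ∃ i i', x ∈ T (j, i, i') ∧ y ∈ T (j, i, i')}
    have hsub : {S ∈ {S ∈ Set.range T | S.Nonempty} | x ∈ S} ⊆ Set.range c := by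
      rintro _ ⟨⟨⟨⟨j, i, i'⟩, rfl⟩, -⟩, hx⟩
      refine ⟨j, Set.Subset.antisymm ?_ fun y hy => ⟨i, i', hx, hy⟩⟩
      rintro y ⟨l, l', hxl, hyl⟩
      rwa [hVd j i l x.1 hx.1 hxl.1, hWd j i' l' x.2 hx.2 hxl.2]
    refine (Set.ncard_le_ncard hsub (Set.finite_range c)).trans ?_
    rw [← Set.image_univ]
    refine (Set.ncard_image_le Set.finite_univ).trans ?_
    simp [Set.ncard_univ]

/-! ### Width dimension -/

section Widim

variable {Y Z : Type u} [TopologicalSpace Y] [TopologicalSpace Z]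

/-- `Z` has an `ε`-embedding into a compact metrizable space of dimension at most `n`. -/
def HasEpsEmbedding (ε : ℝ) (ρ : Z → Z → ℝ) (n : ℕ) : Prop :=
  ∃ (P : Type u) (_ : TopologicalSpace P) (_ : CompactSpace P)
    (_ : TopologicalSpace.MetrizableSpace P) (f : Z → P), IsEpsEmbedding ρ ε f ∧ CoveringDimLE P n

theorem HasEpsEmbedding.widim_le [Nonempty Z] {ε : ℝ} {ρ : Z → Z → ℝ} {n : ℕ}
    (h : HasEpsEmbedding ε ρ n) : widim ε ρ ≤ n := by
  obtain ⟨P, _, _, _, f, hf, hn⟩ := h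
  have : Nonempty P := ‹Nonempty Z›.map f
  refine sInf_le_of_le ⟨P, _, ‹_›, ‹_›, f, hf, rfl⟩ ?_
  rw [coveringDim, if_neg (not_isEmpty_of_nonempty P)]
  exact iInf₂_le n hn

/-- Reduces arithmetic in `EReal` to natural numbers; a finite infimum is attained since dimensions
are integers. -/
theorem widim_eq_top_or_exists [Nonempty Z] (ε : ℝ) (ρ : Z → Z → ℝ) :
    widim ε ρ = ⊤ ∨ ∃ n : ℕ, HasEpsEmbedding ε ρ n ∧ widim ε ρ = n := by
  classical
  by_cases h : ∃ n, HasEpsEmbedding ε ρ n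
  · refine Or.inr ⟨Nat.find h, Nat.find_spec h, le_antisymm (Nat.find_spec h).widim_le ?_⟩
    refine le_sInf ?_
    rintro _ ⟨P, _, _, _, f, hf, rfl⟩
    have : Nonempty P := ‹Nonempty Z›.map f
    rw [coveringDim, if_neg (not_isEmpty_of_nonempty P)]
    exact le_iInf₂ fun n hn =>
      EReal.natCast_le_iff.2 (Nat.find_min' h ⟨P, _, ‹_›, ‹_›, f, hf, hn⟩)
  · refine Or.inl (top_le_iff.1 (le_sInf ?_))
    rintro _ ⟨P, _, _, _, f, hf, rfl⟩
    have : Nonempty P := ‹Nonempty Z›.map f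
    rw [coveringDim, if_neg (not_isEmpty_of_nonempty P)]
    exact le_iInf₂ fun n hn => absurd ⟨n, P, _, ‹_›, ‹_›, f, hf, hn⟩ h

theorem widim_nonneg [Nonempty Z] (ε : ℝ) (ρ : Z → Z → ℝ) : 0 ≤ widim ε ρ := by
  rcases widim_eq_top_or_exists ε ρ with h | ⟨n, -, h⟩ <;> rw [h]
  · exact le_top
  · exact_mod_cast Nat.zero_le n

theorem widim_of_isEmpty [IsEmpty Z] (ε : ℝ) (ρ : Z → Z → ℝ) : widim ε ρ = ⊥ := by
  have h : coveringDim (∅ : Set PUnit.{u + 1}) = ⊥ := by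
    rw [coveringDim, if_pos]
    infer_instance
  let f : Z → (∅ : Set PUnit.{u + 1}) := fun z => isEmptyElim z
  have hf : IsEpsEmbedding ρ ε f :=
    ⟨continuous_of_const fun z => isEmptyElim z, fun z => isEmptyElim z⟩
  exact le_bot_iff.1 (sInf_le ⟨_, inferInstance, inferInstance, inferInstance, f, hf, h.symm⟩)

theorem widim_le_of_map {ε δ : ℝ} {ρ : Y → Y → ℝ} {σ : Z → Z → ℝ} {φ : Y → Z} (hφ : Continuous φ)
    (h : ∀ y y', σ (φ y) (φ y') < δ → ρ y y' < ε) : widim ε ρ ≤ widim δ σ := by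
  refine sInf_le_sInf ?_
  rintro _ ⟨P, _, _, _, f, hf, rfl⟩
  exact ⟨P, _, ‹_›, ‹_›, f ∘ φ, ⟨hf.1.comp hφ, fun y y' hy => h y y' (hf.2 _ _ hy)⟩, rfl⟩

theorem widim_le_add [Nonempty Z] {ε ε₁ ε₂ : ℝ} {ρ ρ₁ ρ₂ : Z → Z → ℝ}
    (h : ∀ z z', ρ₁ z z' < ε₁ → ρ₂ z z' < ε₂ → ρ z z' < ε) :
    widim ε ρ ≤ widim ε₁ ρ₁ + widim ε₂ ρ₂ := by
  have hb : ∀ (ε : ℝ) (ρ : Z → Z → ℝ), widim ε ρ ≠ ⊥ := fun ε ρ =>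
    (EReal.bot_lt_zero.trans_le (widim_nonneg ε ρ)).ne'
  rcases widim_eq_top_or_exists ε₁ ρ₁ with h₁ | ⟨n, ⟨P, _, _, _, f, hf, hn⟩, h₁⟩
  · rw [h₁, EReal.top_add_of_ne_bot (hb _ _)]
    exact le_top
  rcases widim_eq_top_or_exists ε₂ ρ₂ with h₂ | ⟨m, ⟨Q, _, _, _, g, hg, hm⟩, h₂⟩
  · rw [h₂, EReal.add_top_of_ne_bot (hb _ _)]
    exact le_top
  rw [h₁, h₂]
  have : HasEpsEmbedding ε ρ (n + m) := by
    refine ⟨P × Q, inferInstance, inferInstance, inferInstance, fun z => (f z, g z),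
      ⟨hf.1.prodMk hg.1, fun z z' hz => ?_⟩, hn.prod hm⟩
    rw [Prod.mk.injEq] at hz
    exact h z z' (hf.2 _ _ hz.1) (hg.2 _ _ hz.2)
  exact_mod_cast this.widim_le

theorem coveringDimLE_of_subsingleton (P : Type u) [TopologicalSpace P] [Subsingleton P] :
    CoveringDimLE P 0 := by
  intro 𝒰 hf ho hc
  rcases isEmpty_or_nonempty P with hP | ⟨⟨p⟩⟩
  · exact ⟨∅, Set.finite_empty, by simp, Subsingleton.elim _ _, by simp, fun x => isEmptyElim x⟩
  · obtain ⟨U, hU, hpU⟩ : p ∈ ⋃₀ 𝒰 := hc ▸ Set.mem_univ p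
    have hUuniv : U = Set.univ := Set.eq_univ_of_forall fun q => Subsingleton.elim p q ▸ hpU
    refine ⟨{Set.univ}, Set.finite_singleton _, by simp, by simp, ?_, fun x => ?_⟩
    · rintro V hV
      exact ⟨U, hU, hUuniv ▸ Set.subset_univ _⟩
    · exact (Set.ncard_le_ncard (fun V hV => hV.1) (Set.finite_singleton _)).trans (by simp)

theorem widim_eq_zero [Nonempty Z] {ε : ℝ} {ρ : Z → Z → ℝ} (h : ∀ z z', ρ z z' < ε) :
    widim ε ρ = 0 := by
  refine le_antisymm ?_ (widim_nonneg ε ρ)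
  have : HasEpsEmbedding ε ρ 0 := ⟨PUnit, inferInstance, inferInstance, inferInstance,
    fun _ => PUnit.unit, ⟨continuous_const, fun z z' _ => h z z'⟩, coveringDimLE_of_subsingleton _⟩
  exact_mod_cast this.widim_le

end Widim

/-! ### Width dimension as a function of the finite set -/

section DynMetric

variable {G : Type v} [Group G] {Z : Type u} [MulAction G Z]

theorem dynMetric_lt_iff {ρ : Z → Z → ℝ} {ε : ℝ} (hε : 0 < ε) {F : Finset G} {x x' : Z} :
    dynMetric ρ F x x' < ε ↔ ∀ g ∈ F, ρ (g • x) (g • x') < ε := by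
  rw [dynMetric]
  rcases isEmpty_or_nonempty F with hF | hF
  · rw [Real.iSup_of_isEmpty]
    rw [Finset.isEmpty_coe_sort] at hF
    simp [hF, hε]
  · constructor
    · intro h g hg
      exact (le_ciSup (f := fun g : F => ρ ((g : G) • x) ((g : G) • x'))
        (Set.finite_range _).bddAbove ⟨g, hg⟩).trans_lt h
    · intro h
      obtain ⟨g, hg⟩ := exists_eq_ciSup_of_finite (f := fun g : F => ρ ((g : G) • x) ((g : G) • x'))
      rw [← hg]
      exact h g g.2

variable [TopologicalSpace Z] {ε : ℝ} (ρ : Z → Z → ℝ)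

theorem widim_dynMetric_empty [Nonempty Z] (hε : 0 < ε) :
    widim ε (dynMetric ρ (∅ : Finset G)) = 0 :=
  widim_eq_zero fun z z' => (dynMetric_lt_iff hε).2 (by simp)

theorem widim_dynMetric_mono (hε : 0 < ε) {A B : Finset G} (h : A ⊆ B) :
    widim ε (dynMetric ρ A) ≤ widim ε (dynMetric ρ B) :=
  widim_le_of_map continuous_id fun z z' hz => by
    rw [dynMetric_lt_iff hε] at hz ⊢
    exact fun g hg => hz g (h hg)

theorem widim_dynMetric_union_le [Nonempty Z] [DecidableEq G] (hε : 0 < ε) (A B : Finset G) :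
    widim ε (dynMetric ρ (A ∪ B)) ≤ widim ε (dynMetric ρ A) + widim ε (dynMetric ρ B) :=
  widim_le_add fun z z' h₁ h₂ => by
    rw [dynMetric_lt_iff hε] at h₁ h₂ ⊢
    intro g hg
    rcases Finset.mem_union.1 hg with hg | hg
    exacts [h₁ g hg, h₂ g hg]

/-- The `A * {g}`-metric is the pullback of the `A`-metric under the continuous map `z ↦ g • z`. -/
theorem widim_dynMetric_mul_singleton_le [ContinuousConstSMul G Z] [DecidableEq G] (hε : 0 < ε)
    (A : Finset G) (g : G) :
    widim ε (dynMetric ρ (A * {g})) ≤ widim ε (dynMetric ρ A) :=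
  widim_le_of_map (continuous_const_smul g) fun z z' h => by
    rw [dynMetric_lt_iff hε] at h ⊢
    intro a ha
    obtain ⟨b, hb, c, hc, rfl⟩ := Finset.mem_mul.1 ha
    rw [Finset.mem_singleton] at hc
    subst hc
    simpa only [mul_smul] using h b hb

theorem widim_dynMetric_mul_singleton [ContinuousConstSMul G Z] [DecidableEq G] (hε : 0 < ε)
    (A : Finset G) (g : G) :
    widim ε (dynMetric ρ (A * {g})) = widim ε (dynMetric ρ A) := by
  refine le_antisymm (widim_dynMetric_mul_singleton_le ρ hε A g) ?_
  have := widim_dynMetric_mul_singleton_le ρ hε (A * {g}) g⁻¹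
  rwa [mul_assoc, Finset.singleton_mul_singleton, mul_inv_cancel, Finset.singleton_one,
    mul_one] at this

end DynMetric

/-! ### Greedy tilings of finite sets -/

section OrnsteinWeiss

variable {G : Type v} [Group G] [DecidableEq G]

/-- The part of `K⁻¹ R` outside `R`, a measure of the failure of `R` to be `K`-invariant. -/
def outerBoundary (K R : Finset G) : Finset G :=
  (K⁻¹ * R) \ R

theorem card_inv_mul_le (K R : Finset G) :
    (K⁻¹ * R).card ≤ R.card + (outerBoundary K R).card := by
  rw [add_comm]
  exact Finset.card_le_card_sdiff_add_card

theorem outerBoundary_mono {K K' : Finset G} (h : K ⊆ K') (R : Finset G) :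
    outerBoundary K R ⊆ outerBoundary K' R :=
  Finset.sdiff_subset_sdiff (Finset.mul_subset_mul_right (Finset.inv_subset_inv h)) le_rfl

/-- Double counting of the pairs `(t, c)` with `t * c ∈ R`: each `t ∈ T` admits exactly the `c ∈ t⁻¹
R`, all of which lie in `T⁻¹ * R`. -/
theorem sum_card_translate_inter (T R : Finset G) :
    ∑ c ∈ T⁻¹ * R, (T * {c} ∩ R).card = T.card * R.card := by
  have h : ∀ c, (T * {c} ∩ R).card = ∑ t ∈ T, if t * c ∈ R then 1 else 0 := by
    intro c
    rw [← Finset.card_filter]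
    refine (Finset.card_bij (fun t _ => t * c) ?_ ?_ ?_).symm
    · intro t ht
      rw [Finset.mem_filter] at ht
      exact Finset.mem_inter.2 ⟨Finset.mul_mem_mul ht.1 (Finset.mem_singleton_self c), ht.2⟩
    · intro a _ b _ hab
      exact mul_right_cancel hab
    · intro x hx
      rw [Finset.mem_inter, Finset.mem_mul] at hx
      obtain ⟨⟨t, ht, c', hc', rfl⟩, hx⟩ := hx
      rw [Finset.mem_singleton] at hc'
      subst hc'
      exact ⟨t, Finset.mem_filter.2 ⟨ht, hx⟩, rfl⟩
  simp only [h]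
  rw [Finset.sum_comm]
  refine Finset.sum_const_nat fun t ht => ?_
  rw [← Finset.card_filter]
  refine Finset.card_bij (fun c _ => t * c) ?_ ?_ ?_
  · intro c hc
    exact (Finset.mem_filter.1 hc).2
  · intro a _ b _ hab
    exact mul_left_cancel hab
  · intro r hr
    refine ⟨t⁻¹ * r, Finset.mem_filter.2 ⟨Finset.mul_mem_mul (Finset.inv_mem_inv ht) hr, ?_⟩, ?_⟩ <;>
      simp [hr]

/-- A set almost invariant under `T` meets some translate of `T` in almost all of it. -/
theorem exists_translate_inter_large {T R : Finset G} (hT : T.Nonempty) {η : ℝ}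
    (h : ((T⁻¹ * R).card : ℝ) < (1 + η) * R.card) :
    ∃ c : G, (T.card : ℝ) ≤ (1 + η) * (T * {c} ∩ R).card := by
  by_contra! hc
  have hR : R.Nonempty := by
    rw [Finset.nonempty_iff_ne_empty]
    rintro rfl
    simp at h
  -- If every translate met `R` in too little, summing over `T⁻¹ * R` would contradict the double
  -- count.
  have h1 : ∑ c ∈ T⁻¹ * R, (1 + η) * ((T * {c} ∩ R).card : ℝ) < ∑ c ∈ T⁻¹ * R, (T.card : ℝ) :=
    Finset.sum_lt_sum_of_nonempty (hT.inv.mul hR) fun c _ => hc c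
  rw [← Finset.mul_sum, ← Nat.cast_sum, sum_card_translate_inter, Finset.sum_const, nsmul_eq_mul,
    Nat.cast_mul] at h1
  have hTpos : (0 : ℝ) < T.card := by exact_mod_cast hT.card_pos
  nlinarith

/-- Removing from `F` translates of a tile `T`, each of which covers a large new part, until the
rest is not almost `T`-invariant any more. -/
theorem exists_greedy_tiling {T : Finset G} (hT : T.Nonempty) (η : ℝ) (F : Finset G) :
    ∃ R ⊆ F, ∃ C : Finset G, F \ R ⊆ T * C ∧ R = F \ (T * C) ∧
      (T.card : ℝ) * C.card ≤ (1 + η) * (F \ R).card ∧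
      (1 + η) * (R.card : ℝ) ≤ (T⁻¹ * R).card := by
  let good : Finset G → Prop := fun R => ∃ C : Finset G, R = F \ (T * C) ∧
      (T.card : ℝ) * C.card ≤ (1 + η) * (F \ R).card
  -- A remainder of least cardinality is chosen; if it were still almost `T`-invariant, a further
  -- translate could be removed, keeping the bound on `C`.
  have hex : ∃ m : ℕ, ∃ R, good R ∧ R.card = m := ⟨_, F, ⟨∅, by simp, by simp⟩, rfl⟩
  classical
  obtain ⟨R, ⟨C, hRC, hcard⟩, hm⟩ := Nat.find_spec hex
  have hRF : R ⊆ F := hRC ▸ Finset.sdiff_subset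
  refine ⟨R, hRF, C, ?_, hRC, hcard, ?_⟩
  · rw [hRC, sdiff_sdiff_right_self]
    exact Finset.inter_subset_right
  by_contra! hlt
  obtain ⟨c, hc⟩ := exists_translate_inter_large hT hlt
  have hTpos : (0 : ℝ) < T.card := by exact_mod_cast hT.card_pos
  have hpos : 0 < (T * {c} ∩ R).card := by
    rw [Nat.pos_iff_ne_zero]
    intro h0
    rw [h0] at hc
    simp at hc
    exact hT.ne_empty hc
  have hsd : R \ (T * {c}) ∪ (T * {c} ∩ R) = R := by
    rw [Finset.inter_comm, Finset.sdiff_union_inter]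
  have hdis : Disjoint (R \ (T * {c})) (T * {c} ∩ R) := by
    rw [Finset.inter_comm]
    exact Finset.disjoint_sdiff_inter _ _
  have hcardR : (R \ (T * {c})).card + (T * {c} ∩ R).card = R.card := by
    rw [← Finset.card_union_of_disjoint hdis, hsd]
  refine Nat.find_min hex (m := (R \ (T * {c})).card) (by omega) ⟨_, ⟨insert c C, ?_, ?_⟩, rfl⟩
  · rw [hRC, Finset.insert_eq, Finset.mul_union, sdiff_sdiff_left, Finset.union_comm]
    rfl
  · have h1 : (F \ (R \ (T * {c}))).card = (F \ R).card + (T * {c} ∩ R).card := by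
      rw [Finset.card_sdiff_of_subset (Finset.sdiff_subset.trans hRF),
        Finset.card_sdiff_of_subset hRF]
      have := Finset.card_le_card hRF
      omega
    rw [h1]
    have h2 : ((insert c C).card : ℝ) ≤ C.card + 1 := by exact_mod_cast Finset.card_insert_le c C
    push_cast
    nlinarith

/-- The outer boundary of `F \ T C` is controlled by those of `F` and of the tiles. -/
theorem card_outerBoundary_sdiff_le (K T C F : Finset G) :
    (outerBoundary K (F \ (T * C))).card ≤
      (outerBoundary K F).card + C.card * ∑ a ∈ K, (T \ ({a⁻¹} * T)).card := by
  -- A point `a⁻¹ * r` outside the remainder has either left `F` or entered a tile `T * {c}`; in the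
  -- latter case it lies near the edge of that tile, since `r` itself is not covered.
  have hsub : outerBoundary K (F \ (T * C)) ⊆
      outerBoundary K F ∪ C.biUnion fun c => K.biUnion fun a => (T \ ({a⁻¹} * T)) * {c} := by
    intro x hx
    rw [outerBoundary, Finset.mem_sdiff, Finset.mem_mul] at hx
    obtain ⟨⟨a', ha', r, hr, rfl⟩, hx⟩ := hx
    rw [Finset.mem_inv] at ha'
    obtain ⟨a, ha, rfl⟩ := ha'
    rw [Finset.mem_sdiff] at hr
    rw [Finset.mem_union]
    by_cases hF : a⁻¹ * r ∈ F
    · right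
      have hTC : a⁻¹ * r ∈ T * C := by
        by_contra hTC
        exact hx (Finset.mem_sdiff.2 ⟨hF, hTC⟩)
      obtain ⟨t, ht, c, hc, htc⟩ := Finset.mem_mul.1 hTC
      refine Finset.mem_biUnion.2 ⟨c, hc, Finset.mem_biUnion.2 ⟨a, ha, ?_⟩⟩
      rw [← htc]
      refine Finset.mul_mem_mul (Finset.mem_sdiff.2 ⟨ht, fun hta => hr.2 ?_⟩)
        (Finset.mem_singleton_self c)
      rw [Finset.mem_mul] at hta
      obtain ⟨b, hb, s, hs, rfl⟩ := hta
      rw [Finset.mem_singleton] at hb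
      subst hb
      have : r = s * c := by
        apply mul_left_cancel (a := a⁻¹)
        rw [← htc, mul_assoc]
      rw [this]
      exact Finset.mul_mem_mul hs hc
    · left
      exact Finset.mem_sdiff.2 ⟨Finset.mul_mem_mul (Finset.inv_mem_inv ha) hr.1, hF⟩
  refine (Finset.card_le_card hsub).trans ((Finset.card_union_le _ _).trans ?_)
  gcongr
  refine (Finset.card_biUnion_le_card_mul _ _ _ fun c _ => ?_)
  refine Finset.card_biUnion_le.trans (Finset.sum_le_sum fun a _ => ?_)
  rw [Finset.card_mul_singleton]

end OrnsteinWeiss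

/-! ### Almost invariance of Følner sets -/

section Folner

variable {G : Type v} [Group G] {F : ℕ → Finset G}

theorem IsFolnerSeq.card_pos (hF : IsFolnerSeq F) (k : ℕ) : (0 : ℝ) < (F k).card := by
  exact_mod_cast (hF.1 k).card_pos

variable [DecidableEq G]

theorem IsFolnerSeq.tendsto_card_sdiff (hF : IsFolnerSeq F) (g : G) :
    Tendsto (fun k => ((F k \ ({g} * F k)).card : ℝ) / (F k).card) atTop (𝓝 0) := by
  refine squeeze_zero (fun k => by positivity) (fun k => ?_) (hF.2 g)
  gcongr
  rw [← Set.ncard_coe_finset]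
  refine Set.ncard_le_ncard ?_ ((F k).finite_toSet.symmDiff (F k).finite_toSet.smul_set)
  rw [Finset.coe_sdiff, Finset.coe_mul, Finset.coe_singleton, Set.singleton_mul]
  exact Set.subset_union_left

theorem IsFolnerSeq.tendsto_card_sdiff' (hF : IsFolnerSeq F) (g : G) :
    Tendsto (fun k => ((({g} * F k) \ F k).card : ℝ) / (F k).card) atTop (𝓝 0) := by
  refine squeeze_zero (fun k => by positivity) (fun k => ?_) (hF.2 g)
  gcongr
  rw [← Set.ncard_coe_finset]
  refine Set.ncard_le_ncard ?_ ((F k).finite_toSet.symmDiff (F k).finite_toSet.smul_set)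
  rw [Finset.coe_sdiff, Finset.coe_mul, Finset.coe_singleton, Set.singleton_mul]
  exact Set.subset_union_right

theorem IsFolnerSeq.eventually_sum_card_sdiff_le (hF : IsFolnerSeq F) (K : Finset G) {κ : ℝ}
    (hκ : 0 < κ) :
    ∀ᶠ k in atTop, ((∑ a ∈ K, (F k \ ({a⁻¹} * F k)).card : ℕ) : ℝ) ≤ κ * (F k).card := by
  have h := tendsto_finsetSum K fun a _ => hF.tendsto_card_sdiff a⁻¹
  rw [Finset.sum_const_zero] at h
  filter_upwards [h.eventually (gt_mem_nhds hκ)] with k hk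
  rw [← Finset.sum_div, div_lt_iff₀ (hF.card_pos k)] at hk
  push_cast
  exact hk.le

theorem IsFolnerSeq.eventually_card_outerBoundary_le (hF : IsFolnerSeq F) (K : Finset G) {κ : ℝ}
    (hκ : 0 < κ) : ∀ᶠ k in atTop, ((outerBoundary K (F k)).card : ℝ) ≤ κ * (F k).card := by
  have h := tendsto_finsetSum K fun a _ => hF.tendsto_card_sdiff' a⁻¹
  rw [Finset.sum_const_zero] at h
  filter_upwards [h.eventually (gt_mem_nhds hκ)] with k hk
  rw [← Finset.sum_div, div_lt_iff₀ (hF.card_pos k)] at hk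
  refine le_trans ?_ hk.le
  have hsub : outerBoundary K (F k) ⊆ K.biUnion fun a => ({a⁻¹} * F k) \ F k := by
    intro x hx
    rw [outerBoundary, Finset.mem_sdiff, Finset.mem_mul] at hx
    obtain ⟨⟨a', ha', r, hr, rfl⟩, hx⟩ := hx
    rw [Finset.mem_inv] at ha'
    obtain ⟨a, ha, rfl⟩ := ha'
    exact Finset.mem_biUnion.2 ⟨a, ha, Finset.mem_sdiff.2
      ⟨Finset.mul_mem_mul (Finset.mem_singleton_self _) hr, hx⟩⟩
  exact_mod_cast (Finset.card_le_card hsub).trans Finset.card_biUnion_le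

end Folner

/-! ### The Ornstein–Weiss lemma -/

section OrnsteinWeiss

variable {G : Type v} [Group G] [DecidableEq G]

/-- A nonnegative, monotone, subadditive and right invariant function of finite subsets. -/
structure IsSubadditiveInvariant (h : Finset G → ℝ) : Prop where
  nonneg : ∀ A, 0 ≤ h A
  empty : h ∅ = 0
  mono : ∀ A B, A ⊆ B → h A ≤ h B
  union_le : ∀ A B, h (A ∪ B) ≤ h A + h B
  mul_singleton : ∀ A g, h (A * {g}) = h A

variable {h : Finset G → ℝ}

theorem IsSubadditiveInvariant.mul_le (hh : IsSubadditiveInvariant h) (T C : Finset G) :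
    h (T * C) ≤ C.card * h T := by
  induction C using Finset.induction_on with
  | empty => simp [hh.empty]
  | insert c C hc ih =>
    rw [Finset.insert_eq, Finset.mul_union, Finset.card_union_of_disjoint (by simpa using hc)]
    refine (hh.union_le _ _).trans ?_
    rw [hh.mul_singleton, Finset.card_singleton]
    push_cast
    linarith

theorem IsSubadditiveInvariant.le_card_mul (hh : IsSubadditiveInvariant h) (F : Finset G) :
    h F ≤ F.card * h {1} := by
  have := hh.mul_le {1} F
  rwa [show ({1} : Finset G) * F = F by rw [Finset.singleton_one, one_mul]] at this

/-- Each round tiles `F` greedily by one `T` and shrinks the remainder by the factor `q = (1 +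
η/2)/(1 + η)`, unless it is already below `η |F|`. In the induction the tile used first is chosen
last, invariant enough for the remainder to be fed to the later rounds. -/
theorem IsSubadditiveInvariant.exists_quasitiling (hh : IsSubadditiveInvariant h) {lam η : ℝ}
    (hlam : 0 ≤ lam) (hη : 0 < η)
    (htile : ∀ (K : Finset G) (κ : ℝ), 0 < κ → ∃ T : Finset G, T.Nonempty ∧
      ((∑ a ∈ K, (T \ ({a⁻¹} * T)).card : ℕ) : ℝ) ≤ κ * T.card ∧ h T ≤ lam * T.card) (n : ℕ) :
    ∃ (K : Finset G) (κ : ℝ), 0 < κ ∧ ∀ F : Finset G,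
      ((outerBoundary K F).card : ℝ) ≤ κ * F.card → ∃ R ⊆ F,
        h (F \ R) ≤ lam * (1 + η) * (F \ R).card ∧
          (R.card : ℝ) ≤ max (((1 + η / 2) / (1 + η)) ^ n) η * F.card := by
  induction n with
  | zero =>
    refine ⟨∅, 1, one_pos, fun F _ => ⟨F, le_rfl, by simp [hh.empty], ?_⟩⟩
    rw [pow_zero]
    exact le_mul_of_one_le_left (Nat.cast_nonneg _) (le_max_left _ _)
  | succ n ih =>
    obtain ⟨K, κ, hκ, hK⟩ := ih
    have h1η : 0 < 1 + η := by linarith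
    -- As `|T| |C| ≤ (1 + η)|F|`, the tile edges contribute at most `κη/2 |F|` to the boundary of
    -- the remainder, and `F` contributes as much; together `κη |F| < κ |R|` unless `R` is small.
    obtain ⟨T, hT, hTK, hTh⟩ := htile K (κ * η / (2 * (1 + η))) (by positivity)
    refine ⟨K ∪ T, min (η / 2) (κ * η / 2), by positivity, fun F hF => ?_⟩
    obtain ⟨R, hRF, C, hcov, hRC, hCcard, hRcard⟩ := exists_greedy_tiling hT η F
    have hFn : (0 : ℝ) ≤ F.card := Nat.cast_nonneg _
    have hbT : ((outerBoundary T F).card : ℝ) ≤ η / 2 * F.card := by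
      refine le_trans ?_ (hF.trans (mul_le_mul_of_nonneg_right (min_le_left _ _) hFn))
      exact_mod_cast Finset.card_le_card (outerBoundary_mono Finset.subset_union_right F)
    have hbK : ((outerBoundary K F).card : ℝ) ≤ κ * η / 2 * F.card := by
      refine le_trans ?_ (hF.trans (mul_le_mul_of_nonneg_right (min_le_right _ _) hFn))
      exact_mod_cast Finset.card_le_card (outerBoundary_mono Finset.subset_union_left F)
    set q := (1 + η / 2) / (1 + η) with hq
    have hq0 : 0 ≤ q := by positivity
    have hRq : (R.card : ℝ) ≤ q * F.card := by
      have h1 : ((T⁻¹ * R).card : ℝ) ≤ (T⁻¹ * F).card := by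
        exact_mod_cast Finset.card_le_card (Finset.mul_subset_mul_left hRF)
      have h2 : ((T⁻¹ * F).card : ℝ) ≤ F.card + (outerBoundary T F).card := by
        exact_mod_cast card_inv_mul_le T F
      rw [hq, div_mul_eq_mul_div, le_div_iff₀ h1η]
      linarith
    have hhR : h (F \ R) ≤ lam * (1 + η) * (F \ R).card := by
      calc h (F \ R) ≤ h (T * C) := hh.mono _ _ hcov
        _ ≤ C.card * h T := hh.mul_le T C
        _ ≤ C.card * (lam * T.card) := by gcongr
        _ = lam * (T.card * C.card) := by ring
        _ ≤ lam * ((1 + η) * (F \ R).card) := by gcongr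
        _ = _ := by ring
    by_cases hsmall : (R.card : ℝ) ≤ η * F.card
    · exact ⟨R, hRF, hhR, hsmall.trans (mul_le_mul_of_nonneg_right (le_max_right _ _) hFn)⟩
    rw [not_le] at hsmall
    have hb : ((outerBoundary K R).card : ℝ) ≤ κ * R.card := by
      have h1 : ((outerBoundary K R).card : ℝ) ≤
          (outerBoundary K F).card + C.card * (∑ a ∈ K, (T \ ({a⁻¹} * T)).card : ℕ) := by
        rw [hRC]
        exact_mod_cast card_outerBoundary_sdiff_le K T C F
      have h2 : (C.card : ℝ) * (∑ a ∈ K, (T \ ({a⁻¹} * T)).card : ℕ) ≤ κ * η / 2 * F.card := by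
        calc (C.card : ℝ) * (∑ a ∈ K, (T \ ({a⁻¹} * T)).card : ℕ)
            ≤ C.card * (κ * η / (2 * (1 + η)) * T.card) := by gcongr
          _ = κ * η / (2 * (1 + η)) * (T.card * C.card) := by ring
          _ ≤ κ * η / (2 * (1 + η)) * ((1 + η) * (F \ R).card) := by gcongr
          _ = κ * η / 2 * (F \ R).card := by field_simp
          _ ≤ κ * η / 2 * F.card := by
            gcongr
            exact Finset.sdiff_subset
      have h3 : κ * (η * F.card) ≤ κ * R.card := by gcongr
      linarith
    obtain ⟨R', hR'R, hhR', hR'card⟩ := hK R hb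
    refine ⟨R', hR'R.trans hRF, ?_, ?_⟩
    · have hun : F \ R' = (F \ R) ∪ (R \ R') := by
        rw [Finset.union_comm]
        exact (sdiff_sup_sdiff_cancel hRF hR'R).symm.trans (sup_comm _ _)
      have hdis : Disjoint (F \ R) (R \ R') :=
        Finset.disjoint_of_subset_right Finset.sdiff_subset Finset.sdiff_disjoint
      rw [hun, Finset.card_union_of_disjoint hdis]
      push_cast
      have := hh.union_le (F \ R) (R \ R')
      linarith
    · refine hR'card.trans ?_
      rcases le_total (q ^ n) η with hle | hle
      · rw [max_eq_right hle]
        have h1 : (R.card : ℝ) ≤ F.card := by exact_mod_cast Finset.card_le_card hRF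
        exact mul_le_mul (le_max_right _ _) h1 (Nat.cast_nonneg _) (hη.le.trans (le_max_right _ _))
      · rw [max_eq_left hle]
        calc q ^ n * R.card ≤ q ^ n * (q * F.card) := by gcongr
          _ = q ^ (n + 1) * F.card := by ring
          _ ≤ _ := mul_le_mul_of_nonneg_right (le_max_left _ _) hFn

/-- Sets `A k` with small ratio serve as tiles for `F k`. The choice of `η` makes both the overlaps,
costing `lam * η`, and the remainder, costing `η * h {1}`, fit into `ε`. -/
theorem IsSubadditiveInvariant.eventually_le (hh : IsSubadditiveInvariant h)
    {A F : ℕ → Finset G} (hA : IsFolnerSeq A) (hF : IsFolnerSeq F) {lam ε : ℝ} (hε : 0 < ε)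
    (hfreq : ∃ᶠ k in atTop, h (A k) / (A k).card ≤ lam) :
    ∀ᶠ k in atTop, h (F k) / (F k).card ≤ lam + ε := by
  have hlam : 0 ≤ lam := by
    obtain ⟨k, hk⟩ := hfreq.exists
    exact (div_nonneg (hh.nonneg _) (Nat.cast_nonneg _)).trans hk
  have h1 := hh.nonneg {1}
  set η := ε / (lam + h {1} + 1) with hηdef
  have hη : 0 < η := by positivity
  obtain ⟨n, hn⟩ := exists_pow_lt_of_lt_one hη
    (show (1 + η / 2) / (1 + η) < 1 by rw [div_lt_one (by linarith)]; linarith)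
  obtain ⟨K, κ, hκ, hK⟩ := hh.exists_quasitiling hlam hη (fun K κ hκ => by
    obtain ⟨k, hk1, hk2⟩ := (hfreq.and_eventually (hA.eventually_sum_card_sdiff_le K hκ)).exists
    exact ⟨A k, hA.1 k, hk2, (div_le_iff₀ (hA.card_pos k)).1 hk1⟩) n
  filter_upwards [hF.eventually_card_outerBoundary_le K hκ] with k hk
  obtain ⟨R, hRF, hR, hRcard⟩ := hK _ hk
  rw [max_eq_right hn.le] at hRcard
  rw [div_le_iff₀ (hF.card_pos k)]
  have h2 : h (F k) ≤ h (F k \ R) + h R := by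
    have := hh.union_le (F k \ R) R
    rwa [Finset.sdiff_union_of_subset hRF] at this
  have h3 : ((F k \ R).card : ℝ) ≤ (F k).card := by
    exact_mod_cast Finset.card_le_card Finset.sdiff_subset
  have h4 : η * (lam + h {1} + 1) = ε := div_mul_cancel₀ _ (by positivity)
  have hFn : (0 : ℝ) ≤ (F k).card := Nat.cast_nonneg _
  calc h (F k) ≤ lam * (1 + η) * (F k \ R).card + R.card * h {1} :=
        h2.trans (add_le_add hR (hh.le_card_mul R))
    _ ≤ lam * (1 + η) * (F k).card + η * (F k).card * h {1} := by gcongr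
    _ = (lam + (η * (lam + h {1} + 1) - η)) * (F k).card := by ring
    _ ≤ (lam + ε) * (F k).card := by
      rw [h4]
      gcongr
      linarith

/-- The Ornstein–Weiss lemma. -/
theorem IsSubadditiveInvariant.exists_tendsto (hh : IsSubadditiveInvariant h)
    {A : ℕ → Finset G} (hA : IsFolnerSeq A) :
    ∃ L : ℝ, ∀ F : ℕ → Finset G, IsFolnerSeq F →
      Tendsto (fun k => h (F k) / (F k).card) atTop (𝓝 L) := by
  set a : ℕ → ℝ := fun k => h (A k) / (A k).card with ha
  have hbdd : ∀ k, a k ≤ h {1} := fun k => by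
    rw [ha, div_le_iff₀ (hA.card_pos k), mul_comm]
    exact hh.le_card_mul _
  have hnn : ∀ k, 0 ≤ a k := fun k => div_nonneg (hh.nonneg _) (Nat.cast_nonneg _)
  have hb1 : IsBoundedUnder (· ≥ ·) atTop a := isBoundedUnder_of ⟨0, hnn⟩
  have hb2 : IsBoundedUnder (· ≤ ·) atTop a := isBoundedUnder_of ⟨h {1}, hbdd⟩
  refine ⟨liminf a atTop, fun F hF => ?_⟩
  rw [tendsto_order]
  constructor
  · intro b hb
    by_contra hcon
    rw [not_eventually] at hcon
    have hfr : ∃ᶠ k in atTop, h (F k) / (F k).card ≤ b := hcon.mono fun k hk => not_lt.1 hk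
    -- Roles exchanged: sets of `F` now tile those of `A`, pushing the ratios of `A` below their own
    -- liminf.
    have hev := hh.eventually_le hF hA (ε := (liminf a atTop - b) / 2) (by linarith) hfr
    have := liminf_le_of_frequently_le (f := atTop) (u := a) hev.frequently hb1
    linarith
  · intro b hb
    have hfr : ∃ᶠ k in atTop, a k < (liminf a atTop + b) / 2 :=
      frequently_lt_of_liminf_lt hb2.isCoboundedUnder_ge (by linarith)
    have hev := hh.eventually_le hA hF (ε := (b - liminf a atTop) / 4) (by linarith)
      (hfr.mono fun k hk => hk.le)
    filter_upwards [hev] with k hk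
    linarith

end OrnsteinWeiss

/-! ### Compatible metrics and compactness -/

section CompatibleMetric

variable {Y Z : Type u} [TopologicalSpace Y] [TopologicalSpace Z]

theorem IsCompatibleMetric.continuous {ρ : Z → Z → ℝ} (h : IsCompatibleMetric ρ) :
    Continuous fun p : Z × Z => ρ p.1 p.2 := by
  obtain ⟨m, rfl, hρ⟩ := h
  simp only [hρ]
  exact continuous_dist

theorem IsCompatibleMetric.nonneg {ρ : Z → Z → ℝ} (h : IsCompatibleMetric ρ) (x y : Z) :
    0 ≤ ρ x y := by
  obtain ⟨m, rfl, hρ⟩ := h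
  rw [hρ]
  exact dist_nonneg

theorem IsCompatibleMetric.eq_zero_iff {ρ : Z → Z → ℝ} (h : IsCompatibleMetric ρ) {x y : Z} :
    ρ x y = 0 ↔ x = y := by
  obtain ⟨m, rfl, hρ⟩ := h
  rw [hρ]
  exact dist_eq_zero

theorem isCompatibleMetric_dist {X : Type u} [m : MetricSpace X] :
    IsCompatibleMetric fun x y : X => dist x y :=
  ⟨m, rfl, fun _ _ => rfl⟩

theorem exists_isCompatibleMetric (Z : Type u) [TopologicalSpace Z]
    [TopologicalSpace.MetrizableSpace Z] : ∃ ρ : Z → Z → ℝ, IsCompatibleMetric ρ := by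
  let _ := TopologicalSpace.metrizableSpaceMetric Z
  exact ⟨_, isCompatibleMetric_dist⟩

theorem IsCompatibleMetric.exists_pos_forall_lt [CompactSpace Y] {ρ : Y → Y → ℝ} {σ : Z → Z → ℝ}
    (hρ : IsCompatibleMetric ρ) (hσ : IsCompatibleMetric σ) {φ : Y → Z} (hφ : Continuous φ) {ε : ℝ}
    (h : ∀ y y', φ y = φ y' → ρ y y' < ε) :
    ∃ δ > 0, ∀ y y', σ (φ y) (φ y') < δ → ρ y y' < ε := by
  have hK : IsCompact {p : Y × Y | ε ≤ ρ p.1 p.2} :=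
    (isClosed_le continuous_const hρ.continuous).isCompact
  have hcont : Continuous fun p : Y × Y => σ (φ p.1) (φ p.2) :=
    hσ.continuous.comp (hφ.prodMap hφ)
  rcases {p : Y × Y | ε ≤ ρ p.1 p.2}.eq_empty_or_nonempty with he | hne
  · refine ⟨1, one_pos, fun y y' _ => ?_⟩
    by_contra! hle
    exact Set.eq_empty_iff_forall_notMem.1 he (y, y') hle
  · obtain ⟨p, hp, hmin⟩ := hK.exists_isMinOn hne hcont.continuousOn
    refine ⟨σ (φ p.1) (φ p.2), lt_of_le_of_ne (hσ.nonneg _ _) fun h0 => ?_, fun y y' hy => ?_⟩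
    · exact not_lt.2 hp (h _ _ (hσ.eq_zero_iff.1 h0.symm))
    · by_contra! hle
      exact not_lt.2 (hmin (show (y, y') ∈ {p : Y × Y | ε ≤ ρ p.1 p.2} from hle)) hy

end CompatibleMetric

/-! ### Mean width dimension at a fixed scale -/

section MeanWidim

variable {G : Type v} [Group G]

theorem exists_tendsto_widim_dynMetric {Z : Type u} [TopologicalSpace Z] [MulAction G Z]
    [ContinuousConstSMul G Z] {A : ℕ → Finset G} (hA : IsFolnerSeq A) {ε : ℝ} (hε : 0 < ε)
    (ρ : Z → Z → ℝ) : ∃ L : EReal, ∀ F : ℕ → Finset G, IsFolnerSeq F →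
      Tendsto (fun k => widim ε (dynMetric ρ (F k)) / ((F k).card : EReal)) atTop (𝓝 L) := by
  classical
  have hpos : ∀ F : ℕ → Finset G, IsFolnerSeq F → ∀ k, (0 : EReal) < (F k).card := fun F hF k => by
    exact_mod_cast (hF.1 k).card_pos
  rcases isEmpty_or_nonempty Z with hZ | hZ
  · refine ⟨⊥, fun F hF => tendsto_const_nhds.congr fun k => ?_⟩
    rw [widim_of_isEmpty, EReal.bot_div_of_pos_ne_top (hpos F hF k) (EReal.natCast_ne_top _)]
  have hsingle : ∀ g : G, widim ε (dynMetric ρ ({g} : Finset G)) =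
      widim ε (dynMetric ρ ({1} : Finset G)) := fun g => by
    rw [← widim_dynMetric_mul_singleton ρ hε {1} g, Finset.singleton_mul_singleton, one_mul]
  -- By invariance all singletons have the same width dimension: if it is infinite, so are all the
  -- values; if finite, subadditivity makes every value a natural number and Ornstein–Weiss applies.
  by_cases htop : widim ε (dynMetric ρ ({1} : Finset G)) = ⊤
  · refine ⟨⊤, fun F hF => tendsto_const_nhds.congr fun k => ?_⟩
    obtain ⟨g, hg⟩ := hF.1 k
    have : widim ε (dynMetric ρ (F k)) = ⊤ := by
      rw [← top_le_iff, ← htop, ← hsingle g]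
      exact widim_dynMetric_mono ρ hε (Finset.singleton_subset_iff.2 hg)
    rw [this, EReal.top_div_of_pos_ne_top (hpos F hF k) (EReal.natCast_ne_top _)]
  have hfin : ∀ F : Finset G, ∃ n : ℕ, widim ε (dynMetric ρ F) = n := by
    have hsing : ∀ g : G, ∃ n : ℕ, widim ε (dynMetric ρ ({g} : Finset G)) = n := fun g => by
      rcases widim_eq_top_or_exists ε (dynMetric ρ ({g} : Finset G)) with h | ⟨n, -, h⟩
      · exact absurd (hsingle g ▸ h) htop
      · exact ⟨n, h⟩
    intro F
    induction F using Finset.induction_on with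
    | empty => exact ⟨0, by rw [widim_dynMetric_empty ρ hε, Nat.cast_zero]⟩
    | insert g F _ ih =>
      obtain ⟨n, hn⟩ := ih
      obtain ⟨m, hm⟩ := hsing g
      have h1 := widim_dynMetric_union_le ρ hε {g} F
      rw [hn, hm] at h1
      rcases widim_eq_top_or_exists ε (dynMetric ρ (insert g F)) with h | ⟨n, -, h⟩
      · rw [← Finset.insert_eq, h, top_le_iff, ← Nat.cast_add] at h1
        exact absurd h1 (EReal.natCast_ne_top _)
      · exact ⟨n, h⟩
  choose N hN using hfin
  have hh : IsSubadditiveInvariant fun F : Finset G => (N F : ℝ) := by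
    refine ⟨fun _ => Nat.cast_nonneg _, ?_, fun A B hAB => ?_, fun A B => ?_, fun A g => ?_⟩
    · have := hN ∅
      rw [widim_dynMetric_empty ρ hε] at this
      exact_mod_cast this.symm
    · have := widim_dynMetric_mono ρ hε hAB
      rw [hN, hN] at this
      exact_mod_cast EReal.natCast_le_iff.1 this
    · have := widim_dynMetric_union_le ρ hε A B
      rw [hN, hN, hN] at this
      exact_mod_cast this
    · have := widim_dynMetric_mul_singleton ρ hε A g
      rw [hN, hN] at this
      exact_mod_cast this
  obtain ⟨L, hL⟩ := hh.exists_tendsto hA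
  refine ⟨L, fun F hF => ((continuous_coe_real_ereal.tendsto L).comp (hL F hF)).congr fun k => ?_⟩
  rw [hN, Function.comp_apply, EReal.coe_div, EReal.coe_natCast, EReal.coe_natCast]

/-- The mean `ε`-width dimension along a Følner sequence. -/
noncomputable def meanWidim {Z : Type u} [TopologicalSpace Z] [MulAction G Z]
    (A : ℕ → Finset G) (ρ : Z → Z → ℝ) (ε : ℝ) : EReal :=
  liminf (fun k => widim ε (dynMetric ρ (A k)) / ((A k).card : EReal)) atTop

variable {A : ℕ → Finset G} {Y Z : Type u} [TopologicalSpace Z] [MulAction G Z]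
    [TopologicalSpace Y] [MulAction G Y]

theorem tendsto_meanWidim [ContinuousConstSMul G Z] (hA : IsFolnerSeq A) {F : ℕ → Finset G}
    (hF : IsFolnerSeq F) (ρ : Z → Z → ℝ) {ε : ℝ} (hε : 0 < ε) :
    Tendsto (fun k => widim ε (dynMetric ρ (F k)) / ((F k).card : EReal)) atTop
      (𝓝 (meanWidim A ρ ε)) := by
  obtain ⟨L, hL⟩ := exists_tendsto_widim_dynMetric hA hε ρ
  rw [meanWidim, (hL A hA).liminf_eq]
  exact hL F hF

theorem meanWidim_le {ρ : Y → Y → ℝ} {σ : Z → Z → ℝ} {ε δ : ℝ}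
    (h : ∀ F : Finset G, widim ε (dynMetric ρ F) ≤ widim δ (dynMetric σ F)) :
    meanWidim A ρ ε ≤ meanWidim A σ δ :=
  liminf_le_liminf (Eventually.of_forall fun k =>
    EReal.div_le_div_right_of_nonneg (by exact_mod_cast Nat.zero_le _) (h (A k)))

theorem meanWidim_le_of_map {ρ : Y → Y → ℝ} {σ : Z → Z → ℝ} {ε δ : ℝ} (hε : 0 < ε) (hδ : 0 < δ)
    {φ : Y → Z} (hφ : Continuous φ) (hequiv : ∀ (g : G) y, φ (g • y) = g • φ y)
    (h : ∀ y y', σ (φ y) (φ y') < δ → ρ y y' < ε) : meanWidim A ρ ε ≤ meanWidim A σ δ :=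
  meanWidim_le fun F => widim_le_of_map hφ fun y y' hy => by
    rw [dynMetric_lt_iff hε]
    rw [dynMetric_lt_iff hδ] at hy
    exact fun g hg => h _ _ (by simpa only [hequiv] using hy g hg)

theorem meanWidim_anti (ρ : Z → Z → ℝ) {ε ε' : ℝ} (hε : 0 < ε) (h : ε ≤ ε') :
    meanWidim A ρ ε' ≤ meanWidim A ρ ε :=
  meanWidim_le_of_map (hε.trans_le h) hε continuous_id (fun _ _ => rfl) fun _ _ hy => hy.trans_le h

theorem exists_meanWidim_le_of_map [CompactSpace Y] {ρ : Y → Y → ℝ} {σ : Z → Z → ℝ}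
    (hρ : IsCompatibleMetric ρ) (hσ : IsCompatibleMetric σ) {φ : Y → Z} (hφ : Continuous φ)
    (hequiv : ∀ (g : G) y, φ (g • y) = g • φ y) {ε : ℝ} (hε : 0 < ε)
    (h : ∀ y y', φ y = φ y' → ρ y y' < ε) :
    ∃ δ > 0, meanWidim A ρ ε ≤ meanWidim A σ δ := by
  obtain ⟨δ, hδ, hlt⟩ := hρ.exists_pos_forall_lt hσ hφ h
  exact ⟨δ, hδ, meanWidim_le_of_map hε hδ hφ hequiv hlt⟩

theorem tendsto_meanWidim_iSup (A : ℕ → Finset G) (ρ : Z → Z → ℝ) :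
    Tendsto (meanWidim A ρ) (𝓝[>] 0) (𝓝 (⨆ (ε : ℝ) (_ : 0 < ε), meanWidim A ρ ε)) := by
  rw [tendsto_order]
  constructor
  · intro b hb
    obtain ⟨ε, hε⟩ := lt_iSup_iff.1 hb
    obtain ⟨hε0, hε⟩ := lt_iSup_iff.1 hε
    filter_upwards [Ioo_mem_nhdsGT hε0] with ε' hε'
    exact hε.trans_le (meanWidim_anti ρ hε'.1 hε'.2.le)
  · intro b hb
    filter_upwards [self_mem_nhdsWithin] with ε hε
    exact (le_iSup₂ (f := fun (ε : ℝ) (_ : 0 < ε) => meanWidim A ρ ε) ε hε).trans_lt hb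

/-- A change of metric only replaces `ε` by some `δ`, uniformly in the finite set, so the supremum
over scales is unaffected. -/
theorem isMeanDim_iSup_meanWidim [CompactSpace Z] [ContinuousConstSMul G Z]
    (hA : IsFolnerSeq A) {ρ : Z → Z → ℝ} (hρ : IsCompatibleMetric ρ) :
    IsMeanDim G Z (⨆ (ε : ℝ) (_ : 0 < ε), meanWidim A ρ ε) := by
  have key : ∀ σ τ : Z → Z → ℝ, IsCompatibleMetric σ → IsCompatibleMetric τ →
      (⨆ (ε : ℝ) (_ : 0 < ε), meanWidim A σ ε) ≤ ⨆ (ε : ℝ) (_ : 0 < ε), meanWidim A τ ε := by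
    intro σ τ hσ hτ
    refine iSup₂_le fun ε hε => ?_
    obtain ⟨δ, hδ, hle⟩ := exists_meanWidim_le_of_map (A := A) hσ hτ continuous_id (fun _ _ => rfl)
      hε fun y y' hy => by rwa [hσ.eq_zero_iff.2 (show y = y' from hy)]
    exact hle.trans (le_iSup₂ (f := fun (ε : ℝ) (_ : 0 < ε) => meanWidim A τ ε) δ hδ)
  intro σ hσ F hF
  refine ⟨meanWidim A σ, fun ε hε => tendsto_meanWidim hA hF σ hε, ?_⟩
  rw [le_antisymm (key ρ σ hρ hσ) (key σ ρ hσ hρ)]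
  exact tendsto_meanWidim_iSup A σ

end MeanWidim

/-! ### Basic properties of mean dimension -/

section MeanDim

variable {G : Type v} [Group G] {A : ℕ → Finset G} {Y Z : Type u} [TopologicalSpace Z]
  [CompactSpace Z] [TopologicalSpace.MetrizableSpace Z] [MulAction G Z] [ContinuousConstSMul G Z]
  [TopologicalSpace Y] [CompactSpace Y] [TopologicalSpace.MetrizableSpace Y] [MulAction G Y]
  [ContinuousConstSMul G Y]

theorem isMeanDim_mdim (hA : IsFolnerSeq A) : IsMeanDim G Z (mdim G Z) := by
  obtain ⟨ρ, hρ⟩ := exists_isCompatibleMetric Z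
  exact Classical.epsilon_spec ⟨_, isMeanDim_iSup_meanWidim hA hρ⟩

theorem tendsto_meanWidim_mdim (hA : IsFolnerSeq A) {ρ : Z → Z → ℝ} (hρ : IsCompatibleMetric ρ) :
    Tendsto (meanWidim A ρ) (𝓝[>] 0) (𝓝 (mdim G Z)) := by
  obtain ⟨w, hw, hlim⟩ := isMeanDim_mdim (Z := Z) hA ρ hρ A hA
  refine hlim.congr' ?_
  filter_upwards [self_mem_nhdsWithin] with ε hε
  exact tendsto_nhds_unique (hw ε hε) (tendsto_meanWidim hA hA ρ hε)

theorem mdim_eq_iSup (hA : IsFolnerSeq A) {ρ : Z → Z → ℝ} (hρ : IsCompatibleMetric ρ) :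
    mdim G Z = ⨆ (ε : ℝ) (_ : 0 < ε), meanWidim A ρ ε :=
  tendsto_nhds_unique (tendsto_meanWidim_mdim hA hρ) (tendsto_meanWidim_iSup A ρ)

theorem meanWidim_le_mdim (hA : IsFolnerSeq A) {ρ : Z → Z → ℝ} (hρ : IsCompatibleMetric ρ) {ε : ℝ}
    (hε : 0 < ε) : meanWidim A ρ ε ≤ mdim G Z := by
  rw [mdim_eq_iSup hA hρ]
  exact le_iSup₂ (f := fun (ε : ℝ) (_ : 0 < ε) => meanWidim A ρ ε) ε hε

theorem mdim_le (hA : IsFolnerSeq A) {ρ : Z → Z → ℝ} (hρ : IsCompatibleMetric ρ) {c : EReal}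
    (h : ∀ ε : ℝ, 0 < ε → meanWidim A ρ ε ≤ c) : mdim G Z ≤ c := by
  rw [mdim_eq_iSup hA hρ]
  exact iSup₂_le h

theorem mdim_nonneg [Nonempty Z] (hA : IsFolnerSeq A) : 0 ≤ mdim G Z := by
  obtain ⟨ρ, hρ⟩ := exists_isCompatibleMetric Z
  refine le_trans ?_ (meanWidim_le_mdim hA hρ one_pos)
  exact le_liminf_of_le (h := Eventually.of_forall fun k =>
    EReal.div_nonneg (widim_nonneg _ _) (by exact_mod_cast Nat.zero_le _))

theorem mdim_of_isEmpty [IsEmpty Z] (hA : IsFolnerSeq A) : mdim G Z = ⊥ := by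
  obtain ⟨ρ, hρ⟩ := exists_isCompatibleMetric Z
  refine le_bot_iff.1 (mdim_le hA hρ fun ε hε => ?_)
  have h : ∀ k, widim ε (dynMetric ρ (A k)) / ((A k).card : EReal) = ⊥ := fun k => by
    rw [widim_of_isEmpty, EReal.bot_div_of_pos_ne_top (by exact_mod_cast (hA.1 k).card_pos)
      (EReal.natCast_ne_top _)]
  simp [meanWidim, h]

theorem mdim_of_subsingleton [Nonempty Z] [Subsingleton Z] (hA : IsFolnerSeq A) :
    mdim G Z = 0 := by
  obtain ⟨ρ, hρ⟩ := exists_isCompatibleMetric Z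
  refine le_antisymm (mdim_le hA hρ fun ε hε => ?_) (mdim_nonneg hA)
  have h : ∀ k, widim ε (dynMetric ρ (A k)) / ((A k).card : EReal) = 0 := fun k => by
    rw [widim_eq_zero, EReal.zero_div]
    intro z z'
    rw [dynMetric_lt_iff hε]
    intro g _
    rwa [hρ.eq_zero_iff.2 (Subsingleton.elim _ _)]
  simp [meanWidim, h]

theorem mdim_le_of_injective (hA : IsFolnerSeq A) {φ : Y → Z} (hφ : Continuous φ)
    (hinj : Function.Injective φ) (hequiv : ∀ (g : G) y, φ (g • y) = g • φ y) :
    mdim G Y ≤ mdim G Z := by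
  obtain ⟨ρ, hρ⟩ := exists_isCompatibleMetric Y
  obtain ⟨σ, hσ⟩ := exists_isCompatibleMetric Z
  refine mdim_le hA hρ fun ε hε => ?_
  obtain ⟨δ, hδ, hle⟩ := exists_meanWidim_le_of_map (A := A) hρ hσ hφ hequiv hε fun y y' hy => by
    rwa [hρ.eq_zero_iff.2 (hinj hy)]
  exact hle.trans (meanWidim_le_mdim hA hσ hδ)

end MeanDim

/-! ### Disjoint translates of Følner sets -/

section Translates

variable {G : Type v} [Group G] [DecidableEq G]

theorem exists_card_mul_eq [Infinite G] (F : Finset G) (n : ℕ) :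
    ∃ C : Finset G, C.card = n ∧ (F * C).card = n * F.card := by
  induction n with
  | zero => exact ⟨∅, by simp⟩
  | succ n ih =>
    obtain ⟨C, hC, hFC⟩ := ih
    obtain ⟨c, hc⟩ := Infinite.exists_notMem_finset (C ∪ F⁻¹ * (F * C))
    rw [Finset.mem_union, not_or] at hc
    refine ⟨insert c C, by rw [Finset.card_insert_of_notMem hc.1, hC], ?_⟩
    have hdis : Disjoint (F * {c}) (F * C) := by
      rw [Finset.disjoint_left]
      intro x hx hx'
      obtain ⟨f, hf, c', hc', rfl⟩ := Finset.mem_mul.1 hx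
      rw [Finset.mem_singleton] at hc'
      subst hc'
      exact hc.2 (Finset.mem_mul.2 ⟨f⁻¹, Finset.inv_mem_inv hf, _, hx', inv_mul_cancel_left f c'⟩)
    rw [Finset.insert_eq, Finset.mul_union, Finset.card_union_of_disjoint hdis,
      Finset.card_mul_singleton, hFC]
    ring

/-- Left translation commutes with right multiplication by `C k`, so the symmetric difference grows
at most by the factor `|C k|`, exactly the growth of the set. -/
theorem IsFolnerSeq.mul {F C : ℕ → Finset G} (hF : IsFolnerSeq F) (hC : ∀ k, (C k).Nonempty)
    (hcard : ∀ k, (F k * C k).card = (C k).card * (F k).card) :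
    IsFolnerSeq fun k => F k * C k := by
  refine ⟨fun k => (hF.1 k).mul (hC k), fun g => squeeze_zero (fun k => by positivity)
    (fun k => ?_) (hF.2 g)⟩
  have hsub : ((F k * C k : Finset G) : Set G) ∆ (g • ((F k * C k : Finset G) : Set G)) ⊆
      ((F k : Set G) ∆ (g • (F k : Set G))) * (C k : Set G) := by
    rw [Finset.coe_mul]
    rintro x (⟨hx, hgx⟩ | ⟨hgx, hx⟩)
    · obtain ⟨f, hf, c, hc, rfl⟩ := hx
      refine ⟨f, Or.inl ⟨hf, fun hgf => hgx ?_⟩, c, hc, rfl⟩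
      rw [← smul_mul_assoc]
      exact Set.mul_mem_mul hgf hc
    · rw [← smul_mul_assoc] at hgx
      obtain ⟨f, hf, c, hc, rfl⟩ := hgx
      exact ⟨f, Or.inr ⟨hf, fun hff => hx (Set.mul_mem_mul hff hc)⟩, c, hc, rfl⟩
  have hfin : ((F k : Set G) ∆ (g • (F k : Set G))).Finite :=
    (F k).finite_toSet.symmDiff (F k).finite_toSet.smul_set
  have hle : (((F k * C k : Finset G) : Set G) ∆ (g • ((F k * C k : Finset G) : Set G))).ncard ≤
      ((F k : Set G) ∆ (g • (F k : Set G))).ncard * (C k).card := by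
    refine (Set.ncard_le_ncard hsub (hfin.mul (C k).finite_toSet)).trans ?_
    rw [← Set.ncard_coe_finset (C k)]
    exact Set.natCard_mul_le
  have hCpos : (0 : ℝ) < (C k).card := by exact_mod_cast (hC k).card_pos
  have hFpos := hF.card_pos k
  rw [hcard, Nat.cast_mul, div_le_div_iff₀ (by positivity) hFpos]
  have hle' : (((((F k * C k : Finset G) : Set G) ∆
      (g • ((F k * C k : Finset G) : Set G))).ncard : ℕ) : ℝ) ≤
      ((F k : Set G) ∆ (g • (F k : Set G))).ncard * (C k).card := by exact_mod_cast hle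
  nlinarith

end Translates

/-! ### Finite and infinite powers -/

section Powers

variable {G : Type v} [Group G] {A : ℕ → Finset G} {X : Type u}

theorem widim_dynMetric_pi_le [MetricSpace X] [MulAction G X] [Nonempty X] {ε : ℝ} (hε : 0 < ε)
    (n : ℕ) (F : Finset G) :
    widim ε (dynMetric (fun x y : Fin n → X => dist x y) F) ≤
      n * widim ε (dynMetric (fun x y : X => dist x y) F) := by
  classical
  set W := widim ε (dynMetric (fun x y : X => dist x y) F) with hW
  have hW0 : 0 ≤ W := widim_nonneg _ _
  -- Only the relation `τ s x y < ε` matters; the values `ε - 1` and `ε` merely encode closeness in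
  -- the coordinates from `s`, so that coordinates can be added one at a time.
  let τ : Finset (Fin n) → (Fin n → X) → (Fin n → X) → ℝ := fun s x y =>
    if ∀ i ∈ s, dynMetric (fun x y : X => dist x y) F (x i) (y i) < ε then ε - 1 else ε
  have hτ : ∀ s x y, τ s x y < ε ↔
      ∀ i ∈ s, dynMetric (fun x y : X => dist x y) F (x i) (y i) < ε := fun s x y => by
    by_cases h : ∀ i ∈ s, dynMetric (fun x y : X => dist x y) F (x i) (y i) < ε
    · simp only [τ, if_pos h]
      exact ⟨fun _ => h, fun _ => by linarith⟩
    · simp only [τ, if_neg h, lt_irrefl, h]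
  have hind : ∀ s, widim ε (τ s) ≤ s.card * W := by
    intro s
    induction s using Finset.induction_on with
    | empty =>
      rw [widim_eq_zero fun x y => (hτ _ x y).2 (by simp)]
      simp
    | insert i s hi ih =>
      rw [Finset.card_insert_of_notMem hi, Nat.cast_add, Nat.cast_one,
        EReal.right_distrib_of_nonneg (by exact_mod_cast Nat.zero_le _) zero_le_one, one_mul]
      refine le_trans (widim_le_add (ρ₁ := τ s) (ε₁ := ε) (ε₂ := ε)
        (ρ₂ := fun x y => dynMetric (fun x y : X => dist x y) F (x i) (y i)) ?_)
        (add_le_add ih (widim_le_of_map (continuous_apply i) fun _ _ h => h))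
      intro x y h₁ h₂
      rw [hτ] at h₁ ⊢
      intro j hj
      rcases Finset.mem_insert.1 hj with rfl | hj
      exacts [h₂, h₁ j hj]
  have h := hind Finset.univ
  rw [Finset.card_univ, Fintype.card_fin] at h
  refine le_trans (widim_le_of_map continuous_id fun x y hxy => ?_) h
  rw [dynMetric_lt_iff hε]
  intro g hg
  rw [dist_pi_lt_iff hε]
  intro i
  have := (hτ _ _ _).1 hxy i (Finset.mem_univ i)
  rw [dynMetric_lt_iff hε] at this
  exact this g hg

/-- Uses `x ↦ (c • x)_{c ∈ C}`. This map need not be equivariant, which is harmless because `F` is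
fixed. -/
theorem widim_dynMetric_mul_le_pi [MetricSpace X] [MulAction G X] [ContinuousConstSMul G X]
    [DecidableEq G] {ε : ℝ} (hε : 0 < ε) (F C : Finset G) :
    widim ε (dynMetric (fun x y : X => dist x y) (F * C)) ≤
      widim ε (dynMetric (fun x y : Fin C.card → X => dist x y) F) := by
  refine widim_le_of_map (φ := fun x i => (C.equivFin.symm i : G) • x)
    (continuous_pi fun i => continuous_const_smul _) fun x y h => ?_
  rw [dynMetric_lt_iff hε] at h ⊢
  intro g hg
  obtain ⟨f, hf, c, hc, rfl⟩ := Finset.mem_mul.1 hg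
  have := (dist_le_pi_dist _ _ (C.equivFin ⟨c, hc⟩)).trans_lt (h f hf)
  simpa [mul_smul] using this

variable [TopologicalSpace X] [CompactSpace X] [TopologicalSpace.MetrizableSpace X]
  [MulAction G X] [ContinuousConstSMul G X]

theorem mdim_pi_le [Nonempty X] (hA : IsFolnerSeq A) (n : ℕ) :
    mdim G (Fin n → X) ≤ n * mdim G X := by
  let _ := TopologicalSpace.metrizableSpaceMetric X
  have hn0 : (0 : EReal) ≤ n := by exact_mod_cast Nat.zero_le n
  refine mdim_le hA isCompatibleMetric_dist fun ε hε => ?_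
  refine le_trans ?_ (mul_le_mul_of_nonneg_left
    (meanWidim_le_mdim hA (isCompatibleMetric_dist (X := X)) hε) hn0)
  refine le_of_tendsto_of_tendsto' (tendsto_meanWidim hA hA _ hε)
    (EReal.Tendsto.const_mul (tendsto_meanWidim hA hA _ hε) (Or.inl (EReal.natCast_ne_bot n))
      (Or.inl (EReal.natCast_ne_top n))) fun k => ?_
  rw [EReal.mul_div]
  exact EReal.div_le_div_right_of_nonneg (by exact_mod_cast Nat.zero_le _)
    (widim_dynMetric_pi_le hε n (A k))

theorem le_mdim_pi [Infinite G] (hA : IsFolnerSeq A) {n : ℕ} (hn : n ≠ 0) :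
    n * mdim G X ≤ mdim G (Fin n → X) := by
  classical
  let _ := TopologicalSpace.metrizableSpaceMetric X
  choose C hCn hC using fun k => exists_card_mul_eq (A k) n
  have hB : IsFolnerSeq fun k => A k * C k :=
    hA.mul (fun k => Finset.card_ne_zero.1 (hCn k ▸ hn)) fun k => by rw [hC, hCn]
  have hmul : ∀ {l : Filter ℝ} {w : ℝ → EReal} {L : EReal}, Tendsto w l (𝓝 L) →
      Tendsto (fun ε => (n : EReal) * w ε) l (𝓝 (n * L)) := fun h =>
    EReal.Tendsto.const_mul h (Or.inl (EReal.natCast_ne_bot n)) (Or.inl (EReal.natCast_ne_top n))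
  refine le_of_tendsto
    (hmul (tendsto_meanWidim_mdim hA (isCompatibleMetric_dist (X := X)))) ?_
  filter_upwards [self_mem_nhdsWithin] with ε hε
  refine le_trans ?_ (meanWidim_le_mdim hA (isCompatibleMetric_dist (X := Fin n → X)) hε)
  refine le_of_tendsto_of_tendsto' (EReal.Tendsto.const_mul (tendsto_meanWidim hA hB _ hε)
    (Or.inl (EReal.natCast_ne_bot n)) (Or.inl (EReal.natCast_ne_top n)))
    (tendsto_meanWidim hA hA _ hε) fun k => ?_
  have h := widim_dynMetric_mul_le_pi (X := X) hε (A k) (C k)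
  rw [hCn] at h
  rw [hC, EReal.natCast_mul, EReal.mul_div, mul_comm (n : EReal), mul_comm (n : EReal),
    EReal.mul_div_mul_cancel (EReal.natCast_ne_bot n) (EReal.natCast_ne_top n)
      (by exact_mod_cast hn)]
  exact EReal.div_le_div_right_of_nonneg (by exact_mod_cast Nat.zero_le _) h

theorem mdim_pi_eq [Infinite G] (hA : IsFolnerSeq A) (n : ℕ) :
    mdim G (Fin n → X) = n * mdim G X := by
  rcases eq_or_ne n 0 with rfl | hn
  · rw [mdim_of_subsingleton hA, Nat.cast_zero, zero_mul]
  rcases isEmpty_or_nonempty X with hX | hX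
  · have : Nonempty (Fin n) := ⟨⟨0, Nat.pos_of_ne_zero hn⟩⟩
    rw [mdim_of_isEmpty hA, mdim_of_isEmpty hA,
      EReal.mul_bot_of_pos (by exact_mod_cast Nat.pos_of_ne_zero hn)]
  · exact le_antisymm (mdim_pi_le hA n) (le_mdim_pi hA hn)

/-- Periodic repetition embeds `X^n` equivariantly; padding by a constant would require a fixed
point. -/
theorem mdim_pi_le_mdim_sequence (hA : IsFolnerSeq A) {n : ℕ} (hn : n ≠ 0) :
    mdim G (Fin n → X) ≤ mdim G (ℕ → X) := by
  refine mdim_le_of_injective (φ := fun x i => x ⟨i % n, Nat.mod_lt _ (Nat.pos_of_ne_zero hn)⟩) hA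
    (by fun_prop) (fun x y hxy => funext fun i => ?_) fun _ _ => rfl
  have := congrFun hxy i
  simpa only [Nat.mod_eq_of_lt i.2] using this

/-- By compactness, finitely many coordinates distinguish all pairs at distance at least `ε`, so
projecting to an initial block identifies only `ε`-close points. -/
theorem exists_meanWidim_sequence_le_mdim_pi (hA : IsFolnerSeq A)
    {ρ : (ℕ → X) → (ℕ → X) → ℝ} (hρ : IsCompatibleMetric ρ) {ε : ℝ} (hε : 0 < ε) :
    ∃ n : ℕ, meanWidim A ρ ε ≤ mdim G (Fin n → X) := by
  have hK : IsCompact {p : (ℕ → X) × (ℕ → X) | ε ≤ ρ p.1 p.2} :=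
    (isClosed_le continuous_const hρ.continuous).isCompact
  obtain ⟨t, ht⟩ := hK.elim_finite_subcover
    (fun i : ℕ => {p : (ℕ → X) × (ℕ → X) | p.1 i ≠ p.2 i})
    (fun i => isOpen_ne_fun ((continuous_apply i).comp continuous_fst)
      ((continuous_apply i).comp continuous_snd)) fun p hp => by
        rw [Set.mem_iUnion]
        by_contra! hcon
        have heq : p.1 = p.2 := funext fun i => not_not.1 (hcon i)
        have hp' : ε ≤ ρ p.1 p.2 := hp
        rw [hρ.eq_zero_iff.2 heq] at hp'
        linarith
  refine ⟨t.sup id + 1, ?_⟩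
  obtain ⟨σ, hσ⟩ := exists_isCompatibleMetric (Fin (t.sup id + 1) → X)
  obtain ⟨δ, hδ, hle⟩ := exists_meanWidim_le_of_map (G := G) (A := A) hρ hσ
    (φ := fun x (i : Fin (t.sup id + 1)) => x i) (by fun_prop) (fun _ _ => rfl) hε
    fun x y hxy => by
      by_contra! hlt
      obtain ⟨i, hi, hne⟩ := Set.mem_iUnion₂.1 (ht (show (x, y) ∈ _ from hlt))
      exact hne (congrFun hxy ⟨i, Nat.lt_succ_of_le (Finset.le_sup (f := id) hi)⟩)
  exact hle.trans (meanWidim_le_mdim hA hσ hδ)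

theorem mdim_sequence_eq [Infinite G] (hA : IsFolnerSeq A) :
    mdim G (ℕ → X) = ⊤ * mdim G X := by
  rcases isEmpty_or_nonempty X with hX | hX
  · rw [mdim_of_isEmpty hA, mdim_of_isEmpty hA, EReal.top_mul_bot]
  rcases (mdim_nonneg (G := G) (Z := X) hA).eq_or_lt with h0 | hpos
  · obtain ⟨ρ, hρ⟩ := exists_isCompatibleMetric (ℕ → X)
    rw [← h0, mul_zero]
    refine le_antisymm (mdim_le hA hρ fun ε hε => ?_) (mdim_nonneg hA)
    obtain ⟨n, hn⟩ := exists_meanWidim_sequence_le_mdim_pi hA hρ hε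
    rwa [mdim_pi_eq hA, ← h0, mul_zero] at hn
  · rw [EReal.top_mul_of_pos hpos, EReal.eq_top_iff_forall_lt]
    have hle : ∀ n : ℕ, n ≠ 0 → n * mdim G X ≤ mdim G (ℕ → X) := fun n hn =>
      (mdim_pi_eq (X := X) hA n).ge.trans (mdim_pi_le_mdim_sequence hA hn)
    intro y
    -- A real `r` below the mean dimension, which may be infinite, makes the Archimedean argument
    -- available.
    obtain ⟨r, hr0, hr⟩ := EReal.lt_iff_exists_real_btwn.1 hpos
    have hr0' : 0 < r := by exact_mod_cast hr0
    obtain ⟨n, hn⟩ := exists_nat_gt (max (y / r) 0)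
    have hn0 : (0 : ℝ) < n := (le_max_right _ _).trans_lt hn
    have hy : y < n * r := (div_lt_iff₀ hr0').1 ((le_max_left _ _).trans_lt hn)
    refine lt_of_lt_of_le ?_ (hle n (by exact_mod_cast hn0.ne'))
    calc (y : EReal) < ((n * r : ℝ) : EReal) := by exact_mod_cast hy
      _ = n * (r : EReal) := by rw [EReal.coe_mul, EReal.coe_natCast]
      _ ≤ n * mdim G X := mul_le_mul_of_nonneg_left hr.le (by exact_mod_cast Nat.zero_le n)

end Powers

theorem theorem1 {G : Type v} [Group G] [Countable G] [Infinite G] (hG : IsAmenable G)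
    {X : Type u} [TopologicalSpace X] [CompactSpace X] [TopologicalSpace.MetrizableSpace X]
    [MulAction G X] [ContinuousConstSMul G X] :
    IsMeanDim G X (mdim G X) ∧
    (∀ n : ℕ, IsMeanDim G (Fin n → X) (mdim G (Fin n → X)) ∧
      mdim G (Fin n → X) = (n : EReal) * mdim G X) ∧
    IsMeanDim G (ℕ → X) (mdim G (ℕ → X)) ∧
      mdim G (ℕ → X) = (⊤ : EReal) * mdim G X := by
  obtain ⟨A, hA⟩ := hG
  exact ⟨isMeanDim_mdim hA, fun n => ⟨isMeanDim_mdim hA, mdim_pi_eq hA n⟩, isMeanDim_mdim hA,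
    mdim_sequence_eq hA⟩
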